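/- Let $j:\mathbb H\to\mathbb C$ be the elliptic modular function on the upper half-plane $\mathbb H$, and let $\mathrm{GL}_2^+(\mathbb Q)$ (rational $2\times 2$ matrices with positive determinant) act on $\mathbb H$ by $\begin{pmatrix}a&b\\c&d\end{pmatrix}z=\frac{az+b}{cz+d}$. Let $g_1,\ldots,g_k\in\mathrm{GL}_2^+(\mathbb Q)$ be such that the functions $z\mapsto j(g_1z),\ \ldots,\ z\mapsto j(g_kz)$ on $\mathbb H$ are pairwise distinct. Then these functions are multiplicatively independent modulo constants: there are no integers $n_1,\ldots,n_k$, not all zero, and no $c\in\mathbb C$ such that $$\prod_{i=1}^k j(g_iz)^{n_i}=c$$ as meromorphic functions on $\mathbb H$ (equivalently, at all $z\in\mathbb H$ at which none of the $j(g_iz)$ vanishes). -/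

import Mathlib

open scoped MatrixGroups

/-- The elliptic modular function `j = E₄ ^ 3 / Δ` on the upper half-plane, with `q`-expansion
`q⁻¹ + 744 + 196884 q + ⋯`. Here `Δ = q ∏ (1 - q ^ n) ^ 24 = (E₄ ^ 3 - E₆ ^ 2) / 1728`
never vanishes. -/
noncomputable def modularJ (z : UpperHalfPlane) : ℂ :=
  ModularForm.E₄ z ^ 3 / ModularForm.discriminant z

/-- The translate `z ↦ j (g z)` for `g ∈ GL₂⁺(ℚ)`, which acts on the upper half-plane by
`z ↦ (a z + b) / (c z + d)`. -/
noncomputable def jTranslate (g : GL(2, ℚ)⁺) (z : UpperHalfPlane) : ℂ :=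
  modularJ (Matrix.GeneralLinearGroup.map (Rat.castHom ℝ) (g : GL (Fin 2) ℚ) • z)

/-- Multiplicative independence modulo constants of `f₁, …, f_k : ℍ → ℂ`: there is no relation
`∏ fᵢ ^ nᵢ = c` with integers `nᵢ`, not all zero, and `c ∈ ℂ`.

Exponents may be negative and the `fᵢ` may have zeros, so such a relation is an identity of
meromorphic functions: it is required only at the points where no `fᵢ` vanishes (for holomorphic
`fᵢ`, none identically zero, these form a dense open set). At the other points
Lean's convention `0 ^ (-n) = 0` plays no role. -/
def MultIndepModConstants {k : ℕ} (f : Fin k → UpperHalfPlane → ℂ) : Prop :=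
  ¬ ∃ (n : Fin k → ℤ) (c : ℂ), n ≠ 0 ∧
    ∀ z : UpperHalfPlane, (∀ i, f i z ≠ 0) → ∏ i, f i z ^ n i = c

open UpperHalfPlane hiding I
open Complex ModularForm Filter Topology

/-! ### The zeros of `j` of maximal height -/

/-! Every translate is `z ↦ j (a z + b)` with `a > 0`, by `SL(2, ℤ)`-invariance. Among the factors
with non-zero exponent take one with `a` minimal, and let `z₀` be the point it sends to `ρ`, a zero
of `j`. The other such factors send `z₀` to height at least `√3 / 2`, where the only zeros of `j`
are the integer translates of `ρ`. So one that also vanishes at `z₀` is the same translate. Hence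
exactly one factor with non-zero exponent vanishes at `z₀`, and the product tends to `0` or to
infinity there. The zeros are located without the fundamental domain: at that height the
`q`-expansion of `E₄` is injective in `q`. -/

theorem modularJ_smul (γ : SL(2, ℤ)) (z : ℍ) : modularJ (γ • z) = modularJ z := by
  have h4 : E₄ (γ • z) = denom γ z ^ (4 : ℤ) * E₄ z :=
    SlashInvariantForm.slash_action_eqn'' (Γ := 𝒮ℒ) E₄ (γ := (γ : GL (Fin 2) ℝ)) ⟨γ, rfl⟩ z
  have hΔ : CuspForm.discriminant (γ • z) = denom γ z ^ (12 : ℤ) * CuspForm.discriminant z :=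
    SlashInvariantForm.slash_action_eqn'' (Γ := 𝒮ℒ) CuspForm.discriminant
      (γ := (γ : GL (Fin 2) ℝ)) ⟨γ, rfl⟩ z
  have hd := denom_ne_zero (γ : GL (Fin 2) ℝ) z
  have hz := discriminant_ne_zero z
  rw [show CuspForm.discriminant (γ • z) = discriminant (γ • z) from rfl,
    show CuspForm.discriminant z = discriminant z from rfl] at hΔ
  rw [modularJ, modularJ, h4, hΔ]
  simp only [zpow_ofNat]
  field_simp

theorem modularJ_eq_zero_iff (z : ℍ) : modularJ z = 0 ↔ E₄ z = 0 := by
  simp [modularJ, discriminant_ne_zero]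

theorem exists_modularJ_ne_zero : ∃ z : ℍ, modularJ z ≠ 0 := by
  by_contra! h
  refine EisensteinSeries.E_ne_zero (k := 4) (by norm_num) ⟨2, rfl⟩ ?_
  ext z
  exact (modularJ_eq_zero_iff z).1 (h z)

theorem norm_pow_sub_pow_le {q w : ℂ} {r : ℝ} (hq : ‖q‖ ≤ r) (hw : ‖w‖ ≤ r) (n : ℕ) :
    ‖q ^ (n + 1) - w ^ (n + 1)‖ ≤ (n + 1) * r ^ n * ‖q - w‖ := by
  have hr : 0 ≤ r := (norm_nonneg q).trans hq
  induction n with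
  | zero => simp
  | succ n ih =>
    have hwn : ‖w ^ (n + 1)‖ ≤ r ^ (n + 1) := by rw [norm_pow]; gcongr
    calc ‖q ^ (n + 1 + 1) - w ^ (n + 1 + 1)‖
        = ‖q * (q ^ (n + 1) - w ^ (n + 1)) + w ^ (n + 1) * (q - w)‖ := by congr 1; ring
      _ ≤ ‖q‖ * ‖q ^ (n + 1) - w ^ (n + 1)‖ + ‖w ^ (n + 1)‖ * ‖q - w‖ := by
        rw [← norm_mul, ← norm_mul]
        exact norm_add_le _ _
      _ ≤ r * ((n + 1) * r ^ n * ‖q - w‖) + r ^ (n + 1) * ‖q - w‖ := by gcongr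
      _ = _ := by push_cast; ring

/-- A power series `a₁ q + a₂ q ^ 2 + ⋯` with `a₁ = 1` and `|aₙ| ≤ n ^ 4` is injective on the disc
`|q| ≤ 1 / 128`. -/
theorem eq_of_tsum_eq {a : ℕ → ℂ} (h0 : a 0 = 0) (h1 : a 1 = 1) (ha : ∀ n, ‖a n‖ ≤ n ^ 4)
    {q w : ℂ} (hq : ‖q‖ ≤ 1 / 128) (hw : ‖w‖ ≤ 1 / 128)
    (hsq : Summable fun n ↦ a n * q ^ n) (hsw : Summable fun n ↦ a n * w ^ n)
    (h : ∑' n, a n * q ^ n = ∑' n, a n * w ^ n) : q = w := by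
  have hs : Summable fun n ↦ a n * (q ^ n - w ^ n) := by
    simpa only [mul_sub] using hsq.sub hsw
  have hz : ∑' n, a n * (q ^ n - w ^ n) = 0 := by
    simp only [mul_sub]
    rw [hsq.tsum_sub hsw, h, sub_self]
  rw [← hs.sum_add_tsum_nat_add 2] at hz
  have hpow (n : ℕ) : ((n : ℝ) + 2) ^ 5 ≤ 32 ^ (n + 1) := by
    induction n with
    | zero => norm_num
    | succ n ih =>
      have : ((n + 1 : ℕ) : ℝ) + 2 ≤ 2 * ((n : ℝ) + 2) := by
        push_cast; linarith [n.cast_nonneg (α := ℝ)]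
      calc (((n + 1 : ℕ) : ℝ) + 2) ^ 5 ≤ (2 * ((n : ℝ) + 2)) ^ 5 := by gcongr
        _ = 32 * ((n : ℝ) + 2) ^ 5 := by ring
        _ ≤ 32 * 32 ^ (n + 1) := by gcongr
        _ = _ := by ring
  -- These bounds sum to `‖q - w‖ / 3`, but the tail must cancel the linear term `q - w`, which
  -- forces `q = w`.
  have hb (n : ℕ) : ‖a (n + 2) * (q ^ (n + 2) - w ^ (n + 2))‖ ≤
      (1 / 4 * ‖q - w‖) * (1 / 4) ^ n := by
    calc ‖a (n + 2) * (q ^ (n + 2) - w ^ (n + 2))‖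
        ≤ ((n + 2 : ℕ) : ℝ) ^ 4 * (((n + 1 : ℕ) + 1) * (1 / 128) ^ (n + 1) * ‖q - w‖) := by
          rw [norm_mul]
          exact mul_le_mul (ha _) (norm_pow_sub_pow_le hq hw (n + 1)) (norm_nonneg _) (by positivity)
      _ = ((n : ℝ) + 2) ^ 5 * ((1 / 128) ^ (n + 1) * ‖q - w‖) := by push_cast; ring
      _ ≤ 32 ^ (n + 1) * ((1 / 128) ^ (n + 1) * ‖q - w‖) := by gcongr; exact hpow n
      _ = (32 * (1 / 128)) ^ (n + 1) * ‖q - w‖ := by rw [mul_pow]; ring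
      _ = _ := by norm_num [pow_succ]; ring
  have ht := tsum_of_norm_bounded
    ((hasSum_geometric_of_lt_one (r := 1 / 4) (by norm_num) (by norm_num)).mul_left
      (1 / 4 * ‖q - w‖)) hb
  have : ‖q - w‖ = ‖∑' n, a (n + 2) * (q ^ (n + 2) - w ^ (n + 2))‖ := by
    simp only [Finset.sum_range_succ, Finset.sum_range_zero, h0, h1, zero_mul, zero_add, one_mul,
      pow_one] at hz
    rw [eq_neg_of_add_eq_zero_left hz, norm_neg]
  rw [← this] at ht
  have : ‖q - w‖ = 0 := by
    refine le_antisymm ?_ (norm_nonneg _)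
    norm_num at ht
    linarith
  exact sub_eq_zero.1 (norm_eq_zero.1 this)

/-- `π√3 > 5` and `e ^ 5 > 128`. -/
theorem norm_exp_two_pi_I_le {z : ℍ} (hz : √3 / 2 ≤ z.im) :
    ‖cexp (2 * Real.pi * I * z)‖ ≤ 1 / 128 := by
  have h3 : (1.7 : ℝ) < √3 := Real.lt_sqrt_of_sq_lt (by norm_num)
  have hp := Real.pi_gt_three
  have hre : (2 * Real.pi * I * (z : ℂ)).re ≤ -5 := by
    have : (2 * Real.pi * I * (z : ℂ)).re = -(2 * Real.pi * z.im) := by simp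
    rw [this]
    nlinarith
  rw [Complex.norm_exp]
  calc Real.exp (2 * Real.pi * I * (z : ℂ)).re ≤ Real.exp (-5) := Real.exp_le_exp.2 hre
    _ = (Real.exp 1 ^ 5)⁻¹ := by rw [Real.exp_neg, ← Real.exp_nat_mul]; norm_num
    _ ≤ ((2.7 : ℝ) ^ 5)⁻¹ := by
      gcongr
      linarith [Real.exp_one_gt_d9]
    _ ≤ 1 / 128 := by norm_num

theorem exists_int_add_of_E₄_eq {z w : ℍ} (hz : √3 / 2 ≤ z.im) (hw : √3 / 2 ≤ w.im)
    (h : E₄ z = E₄ w) : ∃ n : ℤ, (z : ℂ) = w + n := by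
  have hk (z : ℍ) := EisensteinSeries.q_expansion_bernoulli (k := 4) (by norm_num) ⟨2, rfl⟩ z
  have hs (z : ℍ) := EisensteinSeries.summable_sigma_mul_cexp_pow (k := 4) (by norm_num) z
  have hb : (2 * (4 : ℕ) / (bernoulli 4 : ℚ) : ℂ) ≠ 0 := by
    rw [show bernoulli 4 = -1 / 30 by decide +kernel]
    norm_num
  rw [hk, hk, sub_right_inj] at h
  have h := mul_left_cancel₀ hb h
  simp_rw [zpow_natCast] at h
  have key (z : ℍ) : ∑' n : ℕ+, (ArithmeticFunction.sigma 3 n : ℂ) *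
      cexp (2 * Real.pi * I * z) ^ (n : ℕ) =
      ∑' n : ℕ, (ArithmeticFunction.sigma 3 n : ℂ) * cexp (2 * Real.pi * I * z) ^ n := by
    rw [← tsum_zero_pnat_eq_tsum_nat (hs z)]
    simp
  rw [key, key] at h
  have hq := eq_of_tsum_eq (by simp) (by simp)
    (fun n ↦ by
      rw [Complex.norm_natCast]
      exact_mod_cast ArithmeticFunction.sigma_le_pow_succ 3 n)
    (norm_exp_two_pi_I_le hz) (norm_exp_two_pi_I_le hw) (hs z) (hs w) h
  obtain ⟨n, hn⟩ := Complex.exp_eq_exp_iff_exists_int.1 hq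
  refine ⟨n, mul_left_cancel₀ Complex.two_pi_I_ne_zero ?_⟩
  linear_combination hn

/-- The third root of unity `(-1 + √3 i) / 2` in the upper half-plane. -/
noncomputable def rhoPoint : ℍ := ⟨⟨-1 / 2, √3 / 2⟩, by simp⟩

theorem rhoPoint_im : rhoPoint.im = √3 / 2 := rfl

theorem rhoPoint_sq_add : (rhoPoint : ℂ) ^ 2 + rhoPoint + 1 = 0 := by
  have h : √3 * √3 = 3 := Real.mul_self_sqrt (by norm_num)
  apply Complex.ext <;> simp [rhoPoint, pow_two] <;> linarith

theorem E₄_rhoPoint : E₄ rhoPoint = 0 := by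
  set γ : SL(2, ℤ) := ⟨!![0, -1; 1, 1], by simp [Matrix.det_fin_two]⟩ with hγ
  have hr := rhoPoint_sq_add
  have hr0 : (rhoPoint : ℂ) + 1 ≠ 0 := fun h ↦ by
    have := congrArg Complex.im h
    simp [rhoPoint] at this
  have hfix : γ • rhoPoint = rhoPoint := by
    ext
    rw [coe_specialLinearGroup_apply, div_eq_iff (by simpa [hγ] using hr0)]
    simp [hγ]
    linear_combination -hr
  have h4 : E₄ (γ • rhoPoint) = denom γ rhoPoint ^ (4 : ℤ) * E₄ rhoPoint :=
    SlashInvariantForm.slash_action_eqn'' (Γ := 𝒮ℒ) E₄ (γ := (γ : GL (Fin 2) ℝ)) ⟨γ, rfl⟩ rhoPoint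
  have hd : denom γ rhoPoint = (rhoPoint : ℂ) + 1 := by rw [ModularGroup.denom_apply]; simp [hγ]
  rw [hfix, hd, zpow_ofNat] at h4
  -- Since `ρ + 1 = -ρ ^ 2`, the factor `1 - (ρ + 1) ^ 4` equals `1 - ρ ^ 2 = ρ + 2`.
  have : E₄ rhoPoint * (rhoPoint + 2) = 0 := by
    linear_combination h4 + E₄ rhoPoint * (rhoPoint ^ 2 + 3 * rhoPoint + 2) * hr
  refine (mul_eq_zero.1 this).resolve_right fun h ↦ ?_
  have := congrArg Complex.im h
  simp [rhoPoint] at this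

theorem modularJ_rhoPoint : modularJ rhoPoint = 0 :=
  (modularJ_eq_zero_iff _).2 E₄_rhoPoint

theorem exists_int_add_rhoPoint_of_modularJ_eq_zero {z : ℍ} (hz : √3 / 2 ≤ z.im)
    (h : modularJ z = 0) : ∃ n : ℤ, (z : ℂ) = rhoPoint + n :=
  exists_int_add_of_E₄_eq hz rhoPoint_im.ge
    (((modularJ_eq_zero_iff z).1 h).trans E₄_rhoPoint.symm)
/-! ### Reduction to affine maps -/

theorem Rat.exists_isCoprime_mul_add_mul_eq_zero (x y : ℚ) :
    ∃ p q : ℤ, IsCoprime p q ∧ p * x + q * y = 0 := by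
  by_cases hy : y = 0
  · exact ⟨0, 1, isCoprime_zero_left.2 isUnit_one, by simp [hy]⟩
  · refine ⟨(x / y).den, -(x / y).num, ?_, ?_⟩
    · exact (Rat.isCoprime_num_den (x / y)).symm.neg_right
    · have h : (x / y) * (x / y).den = (x / y).num := Rat.mul_den_eq_num _
      push_cast
      rw [← h]
      field_simp
      ring

/-- Every translate of `j` by `GL₂⁺(ℚ)` is a translate by an affine map. -/
theorem exists_jTranslate_eq_affine (g : GL(2, ℚ)⁺) :
    ∃ (a : {x : ℝ // 0 < x}) (b : ℝ), ∀ z, jTranslate g z = modularJ (b +ᵥ a • z) := by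
  set G : GL (Fin 2) ℝ := Matrix.GeneralLinearGroup.map (Rat.castHom ℝ) (g : GL (Fin 2) ℚ)
  set A : ℚ := (g : GL (Fin 2) ℚ) 0 0
  set B : ℚ := (g : GL (Fin 2) ℚ) 0 1
  set C : ℚ := (g : GL (Fin 2) ℚ) 1 0
  set D : ℚ := (g : GL (Fin 2) ℚ) 1 1
  have hdet : 0 < A * D - B * C := by
    have := g.2
    rwa [Matrix.mem_glpos, Matrix.GeneralLinearGroup.val_det_apply, Matrix.det_fin_two] at this
  have hGdet : 0 < G.det.val := by
    rw [Matrix.GeneralLinearGroup.val_det_apply, Matrix.det_fin_two]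
    change 0 < (A : ℝ) * D - B * C
    exact_mod_cast hdet
  -- The bottom row `(p, q)` kills the lower left entry of `γ g`; the Bézout coefficients complete
  -- it to `γ` in `SL(2, ℤ)`.
  obtain ⟨p, q, ⟨s, r, hrs⟩, h0⟩ := Rat.exists_isCoprime_mul_add_mul_eq_zero A C
  have hrsQ : (s : ℚ) * p + r * q = 1 := by exact_mod_cast hrs
  have hprod : (r * A - s * C) * (p * B + q * D) = A * D - B * C := by
    linear_combination (A * D - B * C) * hrsQ + (r * B - s * D) * h0
  have hδ : (p * B + q * D : ℚ) ≠ 0 := fun h ↦ by rw [h, mul_zero] at hprod; exact hdet.ne hprod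
  have hα : 0 < (r * A - s * C) / (p * B + q * D) := by
    have : (r * A - s * C) / (p * B + q * D) = (A * D - B * C) / (p * B + q * D) ^ 2 := by
      rw [← hprod]; field_simp
    rw [this]
    positivity
  refine ⟨⟨((r * A - s * C) / (p * B + q * D) : ℚ), by exact_mod_cast hα⟩,
    ((r * B - s * D) / (p * B + q * D) : ℚ), fun z ↦ ?_⟩
  set γ : SL(2, ℤ) := ⟨!![r, -s; p, q], by rw [Matrix.det_fin_two]; simp; linarith⟩ with hγ
  rw [jTranslate, ← modularJ_smul γ]
  congr 1
  have hden : (C : ℂ) * z + D ≠ 0 := denom_ne_zero G z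
  have h0C : (p : ℂ) * A + q * C = 0 := by exact_mod_cast congrArg (Rat.cast : ℚ → ℂ) h0
  have hδC : (p * B + q * D : ℂ) ≠ 0 := by exact_mod_cast hδ
  have hcomb : (p : ℂ) * ((A * z + B) / (C * z + D)) + q = (p * B + q * D) / (C * z + D) := by
    rw [eq_div_iff hden, add_mul, mul_assoc, div_mul_cancel₀ _ hden]
    linear_combination z * h0C
  ext
  rw [coe_specialLinearGroup_apply, coe_smul_of_det_pos hGdet]
  have hnum : num G z / denom G z = ((A : ℂ) * z + B) / (C * z + D) := rfl
  rw [hnum, coe_vadd, coe_pos_real_smul]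
  simp only [hγ, Matrix.of_apply, Matrix.cons_val', Matrix.cons_val_zero, Matrix.cons_val_one,
    Matrix.cons_val_fin_one, algebraMap_int_eq, eq_intCast, ofReal_intCast, hcomb, Complex.real_smul]
  push_cast
  rw [div_div_eq_mul_div, add_mul, mul_assoc, div_mul_cancel₀ _ hden]
  field_simp
  ring

/-! ### Analyticity -/

theorem differentiableOn_modularJ :
    DifferentiableOn ℂ (modularJ ∘ ofComplex) {z | 0 < z.im} := by
  have h4 := UpperHalfPlane.mdifferentiable_iff.1 E₄.holo'
  have hΔ := UpperHalfPlane.mdifferentiable_iff.1 CuspForm.discriminant.holo'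
  exact (h4.pow 3).div hΔ fun z _ ↦ discriminant_ne_zero _

/-- The function `w ↦ j (a w + b)`, extended to `ℂ`. -/
noncomputable def affineJ (a : {x : ℝ // 0 < x}) (b : ℝ) (w : ℂ) : ℂ :=
  (modularJ ∘ ofComplex) (b + a.1 * w)

theorem affineJ_coe (a : {x : ℝ // 0 < x}) (b : ℝ) (z : ℍ) :
    affineJ a b z = modularJ (b +ᵥ a • z) := by
  have : ((b : ℂ) + a.1 * z) = (b +ᵥ a • z : ℍ) := by
    rw [coe_vadd, coe_pos_real_smul, Complex.real_smul]
  rw [affineJ, this, Function.comp_apply, ofComplex_apply]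

theorem analyticOnNhd_affineJ (a : {x : ℝ // 0 < x}) (b : ℝ) :
    AnalyticOnNhd ℂ (affineJ a b) {z | 0 < z.im} := by
  refine DifferentiableOn.analyticOnNhd ?_ isOpen_upperHalfPlaneSet
  refine differentiableOn_modularJ.comp (by fun_prop) fun w hw ↦ ?_
  simpa using mul_pos a.2 hw

theorem exists_vadd_smul_eq (a : {x : ℝ // 0 < x}) (b : ℝ) (z : ℍ) :
    ∃ w : ℍ, b +ᵥ a • w = z :=
  ⟨a⁻¹ • (-b +ᵥ z), by simp⟩

/-- Identity theorem: zeros accumulating at `z` would make `j` vanish identically. -/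
theorem eventually_affineJ_ne_zero (a : {x : ℝ // 0 < x}) (b : ℝ) (z : ℍ) :
    ∀ᶠ w in 𝓝[≠] (z : ℂ), affineJ a b w ≠ 0 := by
  by_contra h
  obtain ⟨z₁, hz₁⟩ := exists_modularJ_ne_zero
  obtain ⟨w, rfl⟩ := exists_vadd_smul_eq a b z₁
  rw [← affineJ_coe] at hz₁
  refine hz₁ ((analyticOnNhd_affineJ a b).eqOn_zero_of_preconnected_of_frequently_eq_zero
    (convex_halfSpace_im_gt 0).isPreconnected z.2 ?_ w.2)
  exact (not_eventually.1 h).mono fun _ ↦ not_not.1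

/-! ### Independence -/

/-- A product of integral powers of functions continuous at `x`, exactly one of which with non-zero
exponent vanishes there, is not constant near `x`. -/
theorem not_eventually_prod_zpow_eq {X ι : Type*} [TopologicalSpace X] [Fintype ι]
    {x : X} [(𝓝[≠] x).NeBot] {F : ι → X → ℂ} {n : ι → ℤ} {i₀ : ι}
    (hF : ∀ i, ContinuousAt (F i) x) (hne : ∀ i, ∀ᶠ w in 𝓝[≠] x, F i w ≠ 0)
    (hn : n i₀ ≠ 0) (h0 : F i₀ x = 0) (hi : ∀ i, i ≠ i₀ → n i ≠ 0 → F i x ≠ 0) (c : ℂ) :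
    ¬ ∀ᶠ w in 𝓝[≠] x, ∏ i, F i w ^ n i = c := by
  classical
  intro h
  have hne' := eventually_all.2 hne
  set P : X → ℂ := fun w ↦ ∏ i ∈ Finset.univ.erase i₀, F i w ^ n i
  have hPx : P x ≠ 0 := by
    refine Finset.prod_ne_zero_iff.2 fun i hmem ↦ ?_
    by_cases hni : n i = 0
    · simp [hni]
    · exact zpow_ne_zero _ (hi i (Finset.ne_of_mem_erase hmem) hni)
  have hPt : Tendsto P (𝓝[≠] x) (𝓝 (P x)) := by
    refine tendsto_finsetProd _ fun i hmem ↦ ?_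
    by_cases hni : n i = 0
    · simp [hni]
    · exact (((hF i).tendsto.mono_left nhdsWithin_le_nhds).zpow₀ _
        (.inl (hi i (Finset.ne_of_mem_erase hmem) hni)))
  have hsplit (w : X) : F i₀ w ^ n i₀ * P w = ∏ i, F i w ^ n i :=
    Finset.mul_prod_erase _ (fun i ↦ F i w ^ n i) (Finset.mem_univ i₀)
  have hpow {m : ℤ} (hm : 0 < m) : Tendsto (fun w ↦ F i₀ w ^ m) (𝓝[≠] x) (𝓝 0) := by
    have := ((hF i₀).tendsto.mono_left nhdsWithin_le_nhds).zpow₀ (l := 𝓝[≠] x) m (.inr hm.le)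
    rwa [h0, zero_zpow _ hm.ne'] at this
  -- A negative exponent gives `P = c * F i₀ ^ (-n i₀) → 0`, against `P x ≠ 0`. A positive one gives
  -- `c = 0`, although no factor vanishes at nearby points.
  rcases hn.lt_or_gt with hneg | hpos
  · have ht : Tendsto P (𝓝[≠] x) (𝓝 0) := by
      refine Tendsto.congr' ?_ (by simpa using (hpow (neg_pos.2 hneg)).mul_const c)
      filter_upwards [h, hne'] with w hw hw'
      rw [← hw, ← hsplit, inv_mul_cancel_left₀ (zpow_ne_zero _ (hw' i₀))]
    exact hPx (tendsto_nhds_unique hPt ht)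
  · have ht : Tendsto (fun _ : X ↦ c) (𝓝[≠] x) (𝓝 0) := by
      refine Tendsto.congr' ?_ (by simpa using (hpow hpos).mul hPt)
      filter_upwards [h] with w hw
      rw [hsplit, hw]
    have hc : c = 0 := tendsto_nhds_unique tendsto_const_nhds ht
    obtain ⟨w, hw, hw'⟩ := (h.and hne').exists
    exact Finset.prod_ne_zero_iff.2 (fun i _ ↦ zpow_ne_zero (n i) (hw' i)) (hw.trans hc)

theorem modularJ_int_vadd (m : ℤ) (z : ℍ) : modularJ ((m : ℝ) +ᵥ z) = modularJ z := by
  rw [← modular_T_zpow_smul, modularJ_smul]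

/-- Two affine translates of `j` agree if, at a point which one map sends to `rhoPoint`, both
translates vanish and the other map has at least the same scaling factor. -/
theorem modularJ_affine_eq_of_zero {a a' : {x : ℝ // 0 < x}} {b b' : ℝ} {z₀ : ℍ}
    (hz₀ : b +ᵥ a • z₀ = rhoPoint) (haa' : a ≤ a') (h : modularJ (b' +ᵥ a' • z₀) = 0) (z : ℍ) :
    modularJ (b' +ᵥ a' • z) = modularJ (b +ᵥ a • z) := by
  have him : a.1 * z₀.im = √3 / 2 := by
    rw [← rhoPoint_im, ← hz₀, vadd_im, pos_real_im]
  have him' : √3 / 2 ≤ (b' +ᵥ a' • z₀).im := by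
    rw [vadd_im, pos_real_im, ← him]
    exact mul_le_mul_of_nonneg_right haa' z₀.im_pos.le
  obtain ⟨m, hm⟩ := exists_int_add_rhoPoint_of_modularJ_eq_zero him' h
  rw [← hz₀] at hm
  simp only [coe_vadd, coe_pos_real_smul, Complex.real_smul] at hm
  have ha : a' = a := by
    have := congrArg Complex.im hm
    simp at this
    exact Subtype.ext (this.resolve_right z₀.im_pos.ne')
  subst ha
  have hb : b' = m + b := by
    have : (b' : ℂ) = m + b := by linear_combination hm
    exact_mod_cast this
  rw [hb, add_vadd, modularJ_int_vadd]

theorem theorem1p3 (k : ℕ) (g : Fin k → GL(2, ℚ)⁺)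
    (hg : Pairwise fun i i' => jTranslate (g i) ≠ jTranslate (g i')) :
    MultIndepModConstants fun i => jTranslate (g i) := by
  rintro ⟨n, c, hn, h⟩
  choose a b hab using fun i ↦ exists_jTranslate_eq_affine (g i)
  obtain ⟨i₁, hi₁⟩ := Function.ne_iff.1 hn
  -- Minimal scaling makes every other relevant map send `z₀` at least as high as `ρ`.
  obtain ⟨i₀, hi₀, hmin⟩ := Finset.exists_min_image (Finset.univ.filter fun i ↦ n i ≠ 0) a
    ⟨i₁, by simpa using hi₁⟩
  simp only [Finset.mem_filter, Finset.mem_univ, true_and] at hi₀ hmin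
  obtain ⟨z₀, hz₀⟩ := exists_vadd_smul_eq (a i₀) (b i₀) rhoPoint
  refine not_eventually_prod_zpow_eq (x := (z₀ : ℂ)) (F := fun i ↦ affineJ (a i) (b i)) (n := n)
    (i₀ := i₀) (fun i ↦ (analyticOnNhd_affineJ _ _ _ z₀.2).continuousAt)
    (fun i ↦ eventually_affineJ_ne_zero _ _ _) hi₀ ?_ (fun i hne hni h0 ↦ ?_) c ?_
  · rw [affineJ_coe, hz₀, modularJ_rhoPoint]
  · rw [affineJ_coe] at h0
    refine hg hne (funext fun z ↦ ?_)
    rw [hab, hab, modularJ_affine_eq_of_zero hz₀ (hmin i hni) h0]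
  · have hU : ∀ᶠ w in 𝓝[≠] (z₀ : ℂ), 0 < w.im :=
      nhdsWithin_le_nhds (isOpen_upperHalfPlaneSet.mem_nhds z₀.2)
    filter_upwards [hU, eventually_all.2 fun i ↦ eventually_affineJ_ne_zero (a i) (b i) z₀]
      with w hw hne
    have hF (i : Fin k) : affineJ (a i) (b i) w = jTranslate (g i) ⟨w, hw⟩ := by
      rw [hab, ← affineJ_coe]
    simp only [hF] at hne ⊢
    exact h ⟨w, hw⟩ hne
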